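/- Let $g:\mathbb{R}^m\to\mathbb{R}\cup\{+\infty\}$ be convex, proper, lower semicontinuous and Lipschitz continuous on $\mathrm{dom}\,g=\{z:g(z)<+\infty\}$. Let $F=(f_1,\dots,f_m):\mathbb{R}^n\to\mathbb{R}^m$, where each $f_i$ is convex and continuously differentiable with $L_i$-Lipschitz gradient ($L_i\ge 0$), and suppose that $g$ is nondecreasing in its $i$-th argument whenever $L_i>0$. Suppose that $g\circ F$ is proper with nonempty set of minimizers $S=\operatorname{argmin} g\circ F$, and that $F(\bar x)\in\operatorname{int}\operatorname{dom} g$ for some $\bar x\in\mathbb{R}^n$. Put $$\Gamma=\{\alpha\in\mathbb{R}^m_+:\ \alpha_i=0\text{ if }L_i=0,\ \alpha_i>0\text{ if }L_i>0\},$$ $$H_\alpha(x,y)=F(x)+\nabla F(x)(y-x)+\tfrac{\alpha}{2}\|y-x\|^2,\qquad p_\alpha(x)=\operatorname{argmin}_{y\in\mathbb{R}^n} g(H_\alpha(x,y)),$$ where $\nabla F$ is the Jacobian matrix, and suppose that $p_\alpha(x)\neq\emptyset$ for all $x\in F^{-1}(\operatorname{dom} g)$ and $\alpha\in\Gamma$.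 The multiproximal method with backtracking starts from $x_0\in F^{-1}(\operatorname{dom} g)$, $\alpha_0\in\Gamma$ and $\eta>1$. For $k=0,1,2,\dots$: 1. set $\tilde\alpha=\alpha_k$ and choose $\tilde x\in p_{\tilde\alpha}(x_k)$; 2. while the coordinatewise inequality $F(\tilde x)\le H_{\tilde\alpha}(x_k,\tilde x)$ fails (in at least one coordinate), multiply by $\eta$ each $\tilde\alpha_i$ for which $f_i(\tilde x)>f_i(x_k)+\nabla f_i(x_k)^T(\tilde x-x_k)+\frac{\tilde\alpha_i}{2}\|\tilde x-x_k\|^2$, and choose a new $\tilde x\in p_{\tilde\alpha}(x_k)$; when the loop ends, set $\alpha_{k+1}=\tilde\alpha$; 3. set $x_{k+1}=x_k$ if $x_k\in p_{\alpha_{k+1}}(x_k)$, and $x_{k+1}=\tilde x$ otherwise. For $y\in p_\alpha(x)$ let $\mathcal{V}_\alpha(x,y)=\{\nu\in\partial g(H_\alpha(x,y)):\ \nabla_yH_\alpha(x,y)^T\nu=0\}$, where $\partial g$ is the convex subdifferential. Let $\hat\alpha\in\mathbb{R}^m$ have entries $\hat\alpha_i=\max\{\eta L_i,(\alpha_0)_i\}$.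 **Theorem.** Let $(x_k)_{k\in\mathbb{N}}$ and $(\alpha_k)_{k\in\mathbb{N}}$ be any sequences generated by this method. Then $\hat\alpha\in\Gamma$, and for every $x_*\in S$ and every sequence $(\nu_j)_{j\ge1}$ with $\nu_j\in\mathcal{V}_{\alpha_j}(x_{j-1},x_j)$ for all $j\ge1$, $$g(F(x_k))-g(F(x_*))\le\frac{\max_{j=1,\dots,k}\hat\alpha^T\nu_j}{2k}\,\|x_0-x_*\|^2\qquad\text{for all }k\ge1.$$ Furthermore, $(x_k)_{k\in\mathbb{N}}$ converges to a point of $S$. -/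

import Mathlib

open Filter Topology
open scoped NNReal

noncomputable section

namespace Multiprox

/-- Effective domain of an extended-real-valued function. -/
def dom {E : Type*} (h : E → EReal) : Set E := {z | h z < ⊤}

/-- `h` takes values in `ℝ ∪ {+∞}` and is not identically `+∞`. -/
def IsProper {E : Type*} (h : E → EReal) : Prop := (∀ z, h z ≠ ⊥) ∧ (dom h).Nonempty

/-- The set of global minimizers. -/
def argmin {E : Type*} (h : E → EReal) : Set E := {y | ∀ z, h y ≤ h z}

/-- The subdifferential of convex analysis (empty outside the domain). -/
def subdifferential {m : ℕ} (g : EuclideanSpace ℝ (Fin m) → EReal)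
    (z : EuclideanSpace ℝ (Fin m)) : Set (EuclideanSpace ℝ (Fin m)) :=
  {v | z ∈ dom g ∧ ∀ z', ((inner ℝ (z' - z) v : ℝ) : EReal) + g z ≤ g z'}

/-- `g` is nondecreasing in its `i`-th argument. -/
def MonotoneInCoord {m : ℕ} (g : EuclideanSpace ℝ (Fin m) → EReal) (i : Fin m) : Prop :=
  ∀ z z' : EuclideanSpace ℝ (Fin m), z i ≤ z' i → (∀ j, j ≠ i → z j = z' j) → g z ≤ g z'

/-- The search space for the vector of inverse step sizes. -/
def stepSet {m : ℕ} (L : Fin m → ℝ≥0) : Set (EuclideanSpace ℝ (Fin m)) :=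
  {α | ∀ i, (L i = 0 → α i = 0) ∧ (0 < L i → 0 < α i)}

variable {n m : ℕ}

/-- The surrogate `H_α(x, y) = F(x) + ∇F(x)(y - x) + (α / 2) ‖y - x‖²`. -/
def surrogate (F : EuclideanSpace ℝ (Fin n) → EuclideanSpace ℝ (Fin m))
    (α : EuclideanSpace ℝ (Fin m)) (x y : EuclideanSpace ℝ (Fin n)) :
    EuclideanSpace ℝ (Fin m) :=
  F x + fderiv ℝ F x (y - x) + (‖y - x‖ ^ 2 / 2) • α

/-- The solution set `p_α(x)` of the subproblem `min_y g (H_α(x, y))`. -/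
def prox (g : EuclideanSpace ℝ (Fin m) → EReal)
    (F : EuclideanSpace ℝ (Fin n) → EuclideanSpace ℝ (Fin m))
    (α : EuclideanSpace ℝ (Fin m)) (x : EuclideanSpace ℝ (Fin n)) :
    Set (EuclideanSpace ℝ (Fin n)) :=
  argmin (fun y => g (surrogate F α x y))

/-- The Lagrange multipliers `V_α(x, y)`: subgradients `ν` of `g` at `H_α(x, y)` with
`∇_y H_α(x, y)ᵀ ν = 0`. -/
def multipliers (g : EuclideanSpace ℝ (Fin m) → EReal)
    (F : EuclideanSpace ℝ (Fin n) → EuclideanSpace ℝ (Fin m))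
    (α : EuclideanSpace ℝ (Fin m)) (x y : EuclideanSpace ℝ (Fin n)) :
    Set (EuclideanSpace ℝ (Fin m)) :=
  {ν | ν ∈ subdifferential g (surrogate F α x y) ∧
    ContinuousLinearMap.adjoint (fderiv ℝ (surrogate F α x) y) ν = 0}

/-- The `for`-loop: every entry of `α` whose surrogate inequality fails at the trial point `y`
is multiplied by `η`. -/
def enlarge (F : EuclideanSpace ℝ (Fin n) → EuclideanSpace ℝ (Fin m)) (η : ℝ)
    (α : EuclideanSpace ℝ (Fin m)) (x y : EuclideanSpace ℝ (Fin n)) :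
    EuclideanSpace ℝ (Fin m) :=
  WithLp.toLp 2 (fun i => if surrogate F α x y i < F y i then η * α i else α i)

/-- `LineSearch g F η x α β y`: the `while`-loop at the point `x`, entered with the vector `α`,
stops after finitely many tries with the vector `β` and the trial point `y`.
In every try the trial point is an arbitrary solution of the current subproblem. -/
inductive LineSearch (g : EuclideanSpace ℝ (Fin m) → EReal)
    (F : EuclideanSpace ℝ (Fin n) → EuclideanSpace ℝ (Fin m)) (η : ℝ)
    (x : EuclideanSpace ℝ (Fin n)) :
    EuclideanSpace ℝ (Fin m) → EuclideanSpace ℝ (Fin m) → EuclideanSpace ℝ (Fin n) → Prop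
  | accept (α : EuclideanSpace ℝ (Fin m)) (y : EuclideanSpace ℝ (Fin n))
      (hy : y ∈ prox g F α x) (hle : ∀ i, F y i ≤ surrogate F α x y i) :
      LineSearch g F η x α α y
  | retry (α β : EuclideanSpace ℝ (Fin m)) (y z : EuclideanSpace ℝ (Fin n))
      (hy : y ∈ prox g F α x) (hlt : ∃ i, surrogate F α x y i < F y i)
      (hrec : LineSearch g F η x (enlarge F η α x y) β z) :
      LineSearch g F η x α β z

/-- `(x_k)` and `(α_k)` are generated by the multiproximal method with backtracking. -/
structure IsGenerated (g : EuclideanSpace ℝ (Fin m) → EReal)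
    (F : EuclideanSpace ℝ (Fin n) → EuclideanSpace ℝ (Fin m)) (L : Fin m → ℝ≥0) (η : ℝ)
    (x : ℕ → EuclideanSpace ℝ (Fin n)) (α : ℕ → EuclideanSpace ℝ (Fin m)) : Prop where
  one_lt : 1 < η
  init_x : F (x 0) ∈ dom g
  init_step : α 0 ∈ stepSet L
  step : ∀ k, ∃ y, LineSearch g F η (x k) (α k) (α (k + 1)) y ∧
    (x k ∈ prox g F (α (k + 1)) (x k) → x (k + 1) = x k) ∧
    (x k ∉ prox g F (α (k + 1)) (x k) → x (k + 1) = y)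

/-- The vector with entries `max {η L_i, (α₀)_i}`. -/
def stepBound (L : Fin m → ℝ≥0) (η : ℝ) (α₀ : EuclideanSpace ℝ (Fin m)) :
    EuclideanSpace ℝ (Fin m) :=
  WithLp.toLp 2 (fun i => max (η * (L i : ℝ)) (α₀ i))

end Multiprox

end

/-! Everything is compared in the order `CoordLE`, along which `g` is nondecreasing: the
linearization of `F` lies below `F`, and at an accepted trial point `F` lies below the surrogate.
Backtracking keeps every step vector in Γ and below the vector α̂.

Rate: pairing the surrogate with a multiplier gives a quadratic in the new point that is stationary
at the accepted one. The subgradient inequality at `F xs` then bounds the gap by a difference of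
squared distances to `xs` (`toReal_sub_le_of_mem_multipliers`), and these differences telescope.

Convergence uses no multipliers. If an iterate is optimal, the sequence stays there. Otherwise
convexity along segments makes the distance to each minimizer nonincreasing (`norm_sub_le`), and the
Slater point absorbs the quadratic term of short steps, which forces the values down to the minimum
(`toReal_le_of_slater`, `tendsto_toReal`). By lower semicontinuity a cluster point is then a
minimizer, and monotone distance to it gives convergence of the whole sequence. -/

namespace Multiprox

/-! ### Convexity and descent inequalities along segments. -/

section Calculus

variable {E : Type*} [NormedAddCommGroup E] [InnerProductSpace ℝ E]

theorem hasDerivAt_comp_lineMap {f : E → ℝ} (hf : Differentiable ℝ f) (x y : E) (t : ℝ) :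
    HasDerivAt (fun s : ℝ => f (AffineMap.lineMap x y s))
      (fderiv ℝ f (AffineMap.lineMap x y t) (y - x)) t :=
  (hf _).hasFDerivAt.comp_hasDerivAt t AffineMap.hasDerivAt_lineMap

/-- The first-order characterization of convexity. -/
theorem fderiv_apply_sub_le_of_convexOn {f : E → ℝ} (hf : Differentiable ℝ f)
    (hc : ConvexOn ℝ Set.univ f) (x y : E) : f x + fderiv ℝ f x (y - x) ≤ f y := by
  have hline : ConvexOn ℝ Set.univ (fun s : ℝ => f (AffineMap.lineMap x y s)) := 
    hc.comp_affineMap (AffineMap.lineMap x y : ℝ →ᵃ[ℝ] E)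
  have h := hline.le_slope_of_hasDerivAt (Set.mem_univ (0 : ℝ)) (Set.mem_univ 1) one_pos
    (hasDerivAt_comp_lineMap hf x y 0)
  simp only [slope_def_field, AffineMap.lineMap_apply_zero, AffineMap.lineMap_apply_one, sub_zero,
    div_one] at h
  linarith

/-- The descent lemma. -/
theorem le_add_fderiv_apply_sub_add [CompleteSpace E] {f : E → ℝ} {K : ℝ≥0} (hf : Differentiable ℝ f)
    (hK : LipschitzWith K (gradient f)) (x y : E) :
    f y ≤ f x + fderiv ℝ f x (y - x) + K / 2 * ‖y - x‖ ^ 2 := by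
  have hgrad : ∀ z v, fderiv ℝ f z v = inner ℝ (gradient f z) v := fun z v => by
    simp [gradient]
  -- The claim is `ψ 1 ≤ ψ 0`; the Lipschitz gradient makes the derivative of `ψ` nonpositive.
  let ψ : ℝ → ℝ := fun t => f (AffineMap.lineMap x y t) - t * fderiv ℝ f x (y - x)
    - K / 2 * ‖y - x‖ ^ 2 * t ^ 2
  have hψ : ∀ t, HasDerivAt ψ (fderiv ℝ f (AffineMap.lineMap x y t) (y - x)
      - fderiv ℝ f x (y - x) - K * ‖y - x‖ ^ 2 * t) t := fun t => by
    have h := ((hasDerivAt_comp_lineMap hf x y t).sub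
      ((hasDerivAt_id t).mul_const (fderiv ℝ f x (y - x)))).sub
      ((hasDerivAt_pow 2 t).const_mul (K / 2 * ‖y - x‖ ^ 2))
    refine h.congr_deriv ?_
    simp
    ring
  have hanti : AntitoneOn ψ (Set.Icc 0 1) := by
    refine antitoneOn_of_deriv_nonpos (convex_Icc 0 1)
      (fun t _ => (hψ t).continuousAt.continuousWithinAt)
      (fun t _ => (hψ t).differentiableAt.differentiableWithinAt) fun t ht => ?_
    rw [interior_Icc] at ht
    rw [(hψ t).deriv, hgrad, hgrad, ← inner_sub_left]
    have h1 := real_inner_le_norm (gradient f (AffineMap.lineMap x y t) - gradient f x) (y - x)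
    have h2 := hK.norm_sub_le (AffineMap.lineMap x y t) x
    have h3 : ‖(AffineMap.lineMap x y t : E) - x‖ = t * ‖y - x‖ := by
      simp [AffineMap.lineMap_apply, norm_smul, abs_of_pos ht.1]
    rw [h3] at h2
    have h4 := mul_le_mul_of_nonneg_right h2 (norm_nonneg (y - x))
    nlinarith
  have h := hanti (Set.left_mem_Icc.2 zero_le_one) (Set.right_mem_Icc.2 zero_le_one) zero_le_one
  simp only [ψ, AffineMap.lineMap_apply_zero, AffineMap.lineMap_apply_one] at h
  linarith

end Calculus

/-! ### Passing between extended and real values. -/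

section ExtendedConvex

variable {E : Type*} {g : E → EReal}

theorem coe_toReal_of_mem_dom (hbot : ∀ z, g z ≠ ⊥) {z : E} (hz : z ∈ dom g) :
    ((g z).toReal : EReal) = g z :=
  EReal.coe_toReal (ne_of_lt hz) (hbot z)

theorem mem_dom_of_le {w z : E} (h : g w ≤ g z) (hz : z ∈ dom g) : w ∈ dom g :=
  lt_of_le_of_lt h hz

theorem toReal_le_of_le (hbot : ∀ z, g z ≠ ⊥) {w z : E} (h : g w ≤ g z) (hz : z ∈ dom g) :
    (g w).toReal ≤ (g z).toReal :=
  EReal.toReal_le_toReal h (hbot w) (ne_of_lt hz)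

theorem le_of_toReal_le (hbot : ∀ z, g z ≠ ⊥) {w z : E} (hw : w ∈ dom g)
    (h : (g w).toReal ≤ (g z).toReal) : g w ≤ g z := by
  by_cases hz : z ∈ dom g
  · rw [← coe_toReal_of_mem_dom hbot hw, ← coe_toReal_of_mem_dom hbot hz]
    exact_mod_cast h
  · exact le_of_lt (lt_of_lt_of_le hw (not_lt.1 hz))

theorem mem_dom_of_mem_argmin (hp : IsProper g) {z : E} (hz : z ∈ argmin g) : z ∈ dom g :=
  hp.2.elim fun w hw => mem_dom_of_le (hz w) hw

end ExtendedConvex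

/-! ### The order adapted to the monotonicity of `g`. -/

variable {n m : ℕ}

/-- The coordinatewise order, with equality required in the coordinates where `L` vanishes. -/
def CoordLE (L : Fin m → ℝ≥0) (z z' : EuclideanSpace ℝ (Fin m)) : Prop :=
  ∀ i, z i ≤ z' i ∧ (L i = 0 → z i = z' i)

namespace CoordLE

variable {L : Fin m → ℝ≥0} {a b c d : EuclideanSpace ℝ (Fin m)}

theorem refl (L : Fin m → ℝ≥0) (a : EuclideanSpace ℝ (Fin m)) : CoordLE L a a :=
  fun _ => ⟨le_rfl, fun _ => rfl⟩

theorem trans (h : CoordLE L a b) (h' : CoordLE L b c) : CoordLE L a c :=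
  fun i => ⟨(h i).1.trans (h' i).1, fun hi => ((h i).2 hi).trans ((h' i).2 hi)⟩

theorem add (h : CoordLE L a b) (h' : CoordLE L c d) : CoordLE L (a + c) (b + d) := fun i => by
  refine ⟨add_le_add (h i).1 (h' i).1, fun hi => ?_⟩
  simp [(h i).2 hi, (h' i).2 hi]

theorem smul {t : ℝ} (ht : 0 ≤ t) (h : CoordLE L a b) : CoordLE L (t • a) (t • b) := fun i => by
  refine ⟨mul_le_mul_of_nonneg_left (h i).1 ht, fun hi => ?_⟩
  simp [(h i).2 hi]

theorem sub_nonneg (h : CoordLE L a b) : CoordLE L 0 (b - a) := fun i => by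
  refine ⟨by simpa using (h i).1, fun hi => ?_⟩
  simp [(h i).2 hi]

end CoordLE

theorem coordLE_zero_of_mem_stepSet {L : Fin m → ℝ≥0} {α : EuclideanSpace ℝ (Fin m)}
    (hα : α ∈ stepSet L) : CoordLE L 0 α := fun i => by
  rcases eq_or_lt_of_le (zero_le (a := L i)) with hi | hi
  · simp [(hα i).1 hi.symm]
  · exact ⟨((hα i).2 hi).le, fun h => absurd h hi.ne'⟩

theorem coordLE_of_mem_stepSet {L : Fin m → ℝ≥0} {α β : EuclideanSpace ℝ (Fin m)}
    (hα : α ∈ stepSet L) (hβ : β ∈ stepSet L) (h : ∀ i, α i ≤ β i) : CoordLE L α β :=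
  fun i => ⟨h i, fun hi => ((hα i).1 hi).trans ((hβ i).1 hi).symm⟩

theorem smul_coordLE_smul {L : Fin m → ℝ≥0} {α : EuclideanSpace ℝ (Fin m)} (hα : CoordLE L 0 α)
    {s t : ℝ} (h : s ≤ t) : CoordLE L (s • α) (t • α) := fun i => by
  refine ⟨mul_le_mul_of_nonneg_right h (hα i).1, fun hi => ?_⟩
  have : α i = 0 := ((hα i).2 hi).symm
  simp [this]

/-- Coordinates are exchanged one at a time; where `L` vanishes `g` need not be monotone, but there
the exchange changes nothing. -/
theorem le_of_coordLE {L : Fin m → ℝ≥0} {g : EuclideanSpace ℝ (Fin m) → EReal}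
    (hg : ∀ i, 0 < L i → MonotoneInCoord g i) {z z' : EuclideanSpace ℝ (Fin m)}
    (h : CoordLE L z z') : g z ≤ g z' := by
  classical
  let w : Finset (Fin m) → EuclideanSpace ℝ (Fin m) :=
    fun s => WithLp.toLp 2 fun i => if i ∈ s then z' i else z i
  have key : ∀ s, g z ≤ g (w s) := fun s => by
    induction s using Finset.induction_on with
    | empty =>
      have : w ∅ = z := by ext i; simp [w]
      rw [this]
    | insert i s hi ih =>
      refine ih.trans ?_
      have hne : ∀ j, j ≠ i → w s j = w (insert i s) j := fun j hj => by simp [w, hj]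
      have hz : w s i = z i := by simp [w, hi]
      have hz' : w (insert i s) i = z' i := by simp [w]
      rcases eq_or_lt_of_le (zero_le (a := L i)) with hL | hL
      · have : w s = w (insert i s) := by
          ext j
          by_cases hj : j = i
          · subst hj; rw [hz, hz', (h j).2 hL.symm]
          · exact hne j hj
        rw [this]
      · exact hg i hL _ _ (by rw [hz, hz']; exact (h i).1) hne
  have : w Finset.univ = z' := by ext i; simp [w]
  exact this ▸ key Finset.univ

/-! ### The model, its linearization and its surrogate. -/

/-- The standing assumptions on the composite model `g ∘ F`. -/
structure IsModel (g : EuclideanSpace ℝ (Fin m) → EReal)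
    (F : EuclideanSpace ℝ (Fin n) → EuclideanSpace ℝ (Fin m)) (L : Fin m → ℝ≥0) : Prop where
  differentiable : ∀ i, Differentiable ℝ (fun x => F x i)
  convex_coord : ∀ i, ConvexOn ℝ Set.univ (fun x => F x i)
  lipschitz : ∀ i, LipschitzWith (L i) (gradient (fun x => F x i))
  ne_bot : ∀ z, g z ≠ ⊥
  convex : ConvexOn ℝ (dom g) (fun z => (g z).toReal)
  mono : ∀ i, 0 < L i → MonotoneInCoord g i

/-- The linearization of `F` at `x`. -/
noncomputable def linearization (F : EuclideanSpace ℝ (Fin n) → EuclideanSpace ℝ (Fin m))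
    (x y : EuclideanSpace ℝ (Fin n)) : EuclideanSpace ℝ (Fin m) :=
  F x + fderiv ℝ F x (y - x)

variable {g : EuclideanSpace ℝ (Fin m) → EReal}
  {F : EuclideanSpace ℝ (Fin n) → EuclideanSpace ℝ (Fin m)} {L : Fin m → ℝ≥0}

theorem surrogate_eq (α : EuclideanSpace ℝ (Fin m)) (x y : EuclideanSpace ℝ (Fin n)) :
    surrogate F α x y = linearization F x y + (‖y - x‖ ^ 2 / 2) • α := rfl

@[simp]
theorem surrogate_self (α : EuclideanSpace ℝ (Fin m)) (x : EuclideanSpace ℝ (Fin n)) :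
    surrogate F α x x = F x := by
  simp [surrogate]

theorem linearization_add_smul (x y z : EuclideanSpace ℝ (Fin n)) (t : ℝ) :
    linearization F x (y + t • (z - y))
      = (1 - t) • linearization F x y + t • linearization F x z := by
  have h : y + t • (z - y) - x = (1 - t) • (y - x) + t • (z - x) := by module
  rw [linearization, h, map_add, map_smul, map_smul, linearization, linearization]
  module

/-- Keeping the exact defect of the squared norm matters: a suitable `t` makes the coefficient of
`α` vanish, and for `y = x` it is of order `t`. -/
theorem surrogate_add_smul (α : EuclideanSpace ℝ (Fin m)) (x y z : EuclideanSpace ℝ (Fin n))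
    (t : ℝ) :
    surrogate F α x (y + t • (z - y)) = (1 - t) • surrogate F α x y
      + t • (linearization F x z
        + ((‖z - x‖ ^ 2 - (1 - t) * ‖z - y‖ ^ 2) / 2) • α) := by
  have h : ‖y + t • (z - y) - x‖ ^ 2
      = (1 - t) * ‖y - x‖ ^ 2 + t * (‖z - x‖ ^ 2 - (1 - t) * ‖z - y‖ ^ 2) := by
    have e1 : y + t • (z - y) - x = (y - x) + t • (z - y) := by module
    have e2 : z - x = (y - x) + (z - y) := by module
    rw [e1, e2, norm_add_sq_real, norm_add_sq_real, inner_smul_right, norm_smul, mul_pow,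
      Real.norm_eq_abs, sq_abs]
    ring
  rw [surrogate_eq, surrogate_eq, linearization_add_smul, h]
  module

namespace IsModel

theorem differentiable_map (h : IsModel g F L) : Differentiable ℝ F :=
  differentiable_euclidean.2 h.differentiable

theorem linearization_apply (h : IsModel g F L) (x y : EuclideanSpace ℝ (Fin n)) (i : Fin m) :
    linearization F x y i = F x i + fderiv ℝ (fun x => F x i) x (y - x) := by
  have hi := (hasFDerivWithinAt_euclidean.1
    (h.differentiable_map x).hasFDerivAt.hasFDerivWithinAt i).hasFDerivAt Filter.univ_mem
  rw [hi.fderiv]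
  rfl

/-- Convexity gives the inequality; for `L i = 0` the descent lemma gives its reverse, the component
being affine. -/
theorem coordLE_linearization (h : IsModel g F L) (x y : EuclideanSpace ℝ (Fin n)) :
    CoordLE L (linearization F x y) (F y) := fun i => by
  have h1 := fderiv_apply_sub_le_of_convexOn (h.differentiable i) (h.convex_coord i) x y
  rw [h.linearization_apply]
  refine ⟨h1, fun hi => le_antisymm h1 ?_⟩
  simpa [hi] using le_add_fderiv_apply_sub_add (h.differentiable i) (h.lipschitz i) x y

theorem coordLE_surrogate (h : IsModel g F L) {α : EuclideanSpace ℝ (Fin m)}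
    (hα : α ∈ stepSet L) {x y : EuclideanSpace ℝ (Fin n)}
    (hle : ∀ i, F y i ≤ surrogate F α x y i) : CoordLE L (F y) (surrogate F α x y) := fun i => by
  refine ⟨hle i, fun hi => ?_⟩
  have h1 := (h.coordLE_linearization x y i).2 hi
  simp [surrogate_eq, h1, (hα i).1 hi]

theorem lt_of_surrogate_lt (h : IsModel g F L) {α : EuclideanSpace ℝ (Fin m)}
    {x y : EuclideanSpace ℝ (Fin n)} {i : Fin m} (hlt : surrogate F α x y i < F y i) :
    α i < L i := by
  have h1 := le_add_fderiv_apply_sub_add (h.differentiable i) (h.lipschitz i) x y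
  rw [surrogate_eq, PiLp.add_apply, PiLp.smul_apply, h.linearization_apply, smul_eq_mul] at hlt
  by_contra! hc
  nlinarith [mul_le_mul_of_nonneg_right hc (sq_nonneg ‖y - x‖)]

theorem le_of_coordLE (h : IsModel g F L) {z z' : EuclideanSpace ℝ (Fin m)}
    (hz : CoordLE L z z') : g z ≤ g z' :=
  Multiprox.le_of_coordLE h.mono hz

end IsModel

/-! ### Backtracking and accepted steps. -/

theorem stepBound_mem_stepSet (η : ℝ) {α : EuclideanSpace ℝ (Fin m)}
    (hα : α ∈ stepSet L) : stepBound L η α ∈ stepSet L := fun i => by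
  refine ⟨fun hi => ?_, fun hi => lt_max_of_lt_right ((hα i).2 hi)⟩
  simp [stepBound, hi, (hα i).1 hi]

theorem enlarge_mem_stepSet {η : ℝ} (hη : 0 < η) {α : EuclideanSpace ℝ (Fin m)}
    (hα : α ∈ stepSet L) (x y : EuclideanSpace ℝ (Fin n)) :
    enlarge F η α x y ∈ stepSet L := fun i => by
  by_cases hlt : surrogate F α x y i < F y i
  · refine ⟨fun hi => ?_, fun hi => ?_⟩
    · simp [enlarge, (hα i).1 hi]
    · simpa [enlarge, hlt] using mul_pos hη ((hα i).2 hi)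
  · simpa [enlarge, hlt] using hα i

/-- An accepted step from `x` to `y` with step vector `α`. -/
structure IsStep (g : EuclideanSpace ℝ (Fin m) → EReal)
    (F : EuclideanSpace ℝ (Fin n) → EuclideanSpace ℝ (Fin m)) (L : Fin m → ℝ≥0)
    (α : EuclideanSpace ℝ (Fin m)) (x y : EuclideanSpace ℝ (Fin n)) : Prop where
  mem_stepSet : α ∈ stepSet L
  mem_prox : y ∈ prox g F α x
  coordLE : CoordLE L (F y) (surrogate F α x y)

/-- By the descent lemma an entry is multiplied by `η` only while it is below `L i`, so it never
exceeds `η * L i` as a result. -/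
theorem LineSearch.isStep (h : IsModel g F L) {η : ℝ} (hη : 1 < η)
    {x y : EuclideanSpace ℝ (Fin n)} {α β B : EuclideanSpace ℝ (Fin m)}
    (hB : ∀ i, η * (L i : ℝ) ≤ B i) (hs : LineSearch g F η x α β y) (hα : α ∈ stepSet L)
    (hαB : ∀ i, α i ≤ B i) : IsStep g F L β x y ∧ ∀ i, β i ≤ B i := by
  induction hs with
  | accept α y hy hle => exact ⟨⟨hα, hy, h.coordLE_surrogate hα hle⟩, hαB⟩
  | retry α β y z hy hlt hrec ih =>
    refine ih (enlarge_mem_stepSet (zero_lt_one.trans hη) hα x y) fun i => ?_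
    by_cases hi : surrogate F α x y i < F y i
    · have := mul_le_mul_of_nonneg_left (h.lt_of_surrogate_lt hi).le (zero_le_one.trans hη.le)
      simpa [enlarge, hi] using this.trans (hB i)
    · simpa [enlarge, hi] using hαB i

/-! ### One-step estimates without multipliers. -/

namespace IsStep

variable {α : EuclideanSpace ℝ (Fin m)} {x y : EuclideanSpace ℝ (Fin n)}

theorem refl_of_mem_prox (hα : α ∈ stepSet L) (hx : x ∈ prox g F α x) : IsStep g F L α x x :=
  ⟨hα, hx, by rw [surrogate_self]; exact CoordLE.refl L _⟩

theorem le_surrogate (hs : IsStep g F L α x y) (h : IsModel g F L) :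
    g (F y) ≤ g (surrogate F α x y) := h.le_of_coordLE hs.coordLE

theorem surrogate_le (hs : IsStep g F L α x y) : g (surrogate F α x y) ≤ g (F x) := by
  simpa using hs.mem_prox x

theorem le (hs : IsStep g F L α x y) (h : IsModel g F L) : g (F y) ≤ g (F x) :=
  (hs.le_surrogate h).trans hs.surrogate_le

/-- The optimal subproblem value is at least `g (F y)`, hence at least the minimum of `g ∘ F`, which
`x` attains in its own subproblem. The method therefore stays at a minimizer. -/
theorem mem_prox_self_of_mem_argmin (hs : IsStep g F L α x y) (h : IsModel g F L)
    (hx : x ∈ argmin (g ∘ F)) : x ∈ prox g F α x := fun z => by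
  refine le_trans ?_ (hs.mem_prox z)
  simpa using (hx y).trans (hs.le_surrogate h)

/-- Outside the solution set, the iterates approach every solution. -/
theorem norm_sub_le (hs : IsStep g F L α x y) (h : IsModel g F L) (hx : F x ∈ dom g)
    {xs : EuclideanSpace ℝ (Fin n)} (hxs : xs ∈ argmin (g ∘ F)) (hy : y ∉ argmin (g ∘ F)) :
    ‖xs - y‖ ≤ ‖xs - x‖ := by
  by_contra! hlt
  refine hy fun z => le_trans ?_ (hxs z)
  have hpos : 0 < ‖xs - y‖ := (norm_nonneg _).trans_lt hlt
  -- This `t` cancels the quadratic correction in `surrogate_add_smul`, so the surrogate at `y + t •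
  -- (xs - y)` is a convex combination of its value at `y` and the linearization at `xs`.
  let t : ℝ := 1 - ‖xs - x‖ ^ 2 / ‖xs - y‖ ^ 2
  have ht : (1 - t) * ‖xs - y‖ ^ 2 = ‖xs - x‖ ^ 2 := by
    simp only [t]
    field_simp
    ring
  have ht0 : 0 < t := by
    have : ‖xs - x‖ ^ 2 / ‖xs - y‖ ^ 2 < 1 := by
      rw [div_lt_one (by positivity)]
      gcongr
    simp only [t]
    linarith
  have ht1 : 0 ≤ 1 - t := by simp only [t, sub_sub_cancel]; positivity
  have hxsd : F xs ∈ dom g := lt_of_le_of_lt (hxs x) hx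
  have hHd : surrogate F α x y ∈ dom g := mem_dom_of_le hs.surrogate_le hx
  have hlin := h.le_of_coordLE (h.coordLE_linearization x xs)
  have hld : linearization F x xs ∈ dom g := mem_dom_of_le hlin hxsd
  have hmix := surrogate_add_smul (F := F) α x y xs t
  rw [ht, sub_self, zero_div, zero_smul, add_zero] at hmix
  have hcd : (1 - t) • surrogate F α x y + t • linearization F x xs ∈ dom g :=
    h.convex.1 hHd hld ht1 ht0.le (by ring)
  have h1 : (g (surrogate F α x y)).toReal
      ≤ (g ((1 - t) • surrogate F α x y + t • linearization F x xs)).toReal :=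
    toReal_le_of_le h.ne_bot (hmix ▸ hs.mem_prox (y + t • (xs - y))) hcd
  have h2 := h.convex.2 hHd hld ht1 ht0.le (by ring)
  have h3 := toReal_le_of_le h.ne_bot hlin hxsd
  simp only [smul_eq_mul] at h2
  -- Minimality of `y` and convexity bound the value at `y` by a mean of itself and the linearized
  -- value; dividing by `t > 0` shows that `y` is optimal, a contradiction.
  have h4 : (g (surrogate F α x y)).toReal ≤ (g (F xs)).toReal := by
    refine le_trans ?_ h3
    nlinarith
  exact (hs.le_surrogate h).trans (le_of_toReal_le h.ne_bot hHd h4)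

/-- The decrease of the objective achieved by one step, measured with a Slater point `xb`. -/
theorem toReal_le_of_slater (hs : IsStep g F L α x y) (h : IsModel g F L) (hx : F x ∈ dom g)
    {xs xb : EuclideanSpace ℝ (Fin n)} {β : EuclideanSpace ℝ (Fin m)} (hβ : β ∈ stepSet L)
    (hαβ : ∀ i, α i ≤ β i) {r s t : ℝ} (hxs : F xs ∈ dom g) (hxb : F xb + r • β ∈ dom g)
    (hs0 : 0 ≤ s) (hs1 : s ≤ 1) (ht0 : 0 ≤ t) (ht1 : t ≤ 1)
    (hts : t * ‖xs + s • (xb - xs) - x‖ ^ 2 / 2 ≤ s * r) :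
    (g (F y)).toReal ≤ (1 - t) * (g (F x)).toReal
      + t * ((1 - s) * (g (F xs)).toReal + s * (g (F xb + r • β)).toReal) := by
  set w := xs + s • (xb - xs)
  have hmix := surrogate_add_smul (F := F) α x x w t
  have hcd : (1 - s) • F xs + s • (F xb + r • β) ∈ dom g :=
    h.convex.1 hxs hxb (sub_nonneg.2 hs1) hs0 (by ring)
  -- The quadratic term of the short step towards `w` is paid for by the slack `r • β` at `xb`,
  -- which enters with weight `s`; this is `hts`.
  have hle : CoordLE L (linearization F x w + ((‖w - x‖ ^ 2 - (1 - t) * ‖w - x‖ ^ 2) / 2) • α)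
      ((1 - s) • F xs + s • (F xb + r • β)) := by
    have e : (1 - s) • F xs + s • (F xb + r • β)
        = ((1 - s) • F xs + s • F xb) + (s * r) • β := by module
    have hc : (‖w - x‖ ^ 2 - (1 - t) * ‖w - x‖ ^ 2) / 2 = t * ‖w - x‖ ^ 2 / 2 := by ring
    rw [e, linearization_add_smul, hc]
    refine .add (.add (.smul (sub_nonneg.2 hs1) (h.coordLE_linearization x xs))
      (.smul hs0 (h.coordLE_linearization x xb))) ?_
    exact (CoordLE.smul (by positivity) (coordLE_of_mem_stepSet hs.mem_stepSet hβ hαβ)).trans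
      (smul_coordLE_smul (coordLE_zero_of_mem_stepSet hβ) hts)
  set q := linearization F x w + ((‖w - x‖ ^ 2 - (1 - t) * ‖w - x‖ ^ 2) / 2) • α
  rw [surrogate_self] at hmix
  have hqd : q ∈ dom g := mem_dom_of_le (h.le_of_coordLE hle) hcd
  have hpd : (1 - t) • F x + t • q ∈ dom g :=
    h.convex.1 hx hqd (sub_nonneg.2 ht1) ht0 (by ring)
  have h1 : (g (F y)).toReal ≤ (g ((1 - t) • F x + t • q)).toReal :=
    toReal_le_of_le h.ne_bot
      ((hs.le_surrogate h).trans (hmix ▸ hs.mem_prox (x + t • (w - x)))) hpd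
  have h2 := h.convex.2 hx hqd (sub_nonneg.2 ht1) ht0 (by ring)
  have h3 := toReal_le_of_le h.ne_bot (h.le_of_coordLE hle) hcd
  have h4 := h.convex.2 hxs hxb (sub_nonneg.2 hs1) hs0 (by ring)
  simp only [smul_eq_mul] at h2 h4
  have h5 := mul_le_mul_of_nonneg_left (h3.trans h4) ht0
  linarith

end IsStep

/-! ### Multipliers and the basic estimate. -/

/-- Moving from `z` to `z - a` cannot increase `g`, so the subgradient inequality fixes the sign. -/
theorem inner_nonneg_of_mem_subdifferential (h : IsModel g F L)
    {z ν a : EuclideanSpace ℝ (Fin m)} (hν : ν ∈ subdifferential g z) (ha : CoordLE L 0 a) :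
    0 ≤ inner ℝ a ν := by
  have hle : g (z - a) ≤ g z := h.le_of_coordLE fun i =>
    ⟨by simpa using (ha i).1, fun hi => by simp [← (ha i).2 hi]⟩
  have h1 := (hν.2 (z - a)).trans hle
  rw [← coe_toReal_of_mem_dom h.ne_bot hν.1, ← EReal.coe_add, EReal.coe_le_coe_iff,
    sub_sub_cancel_left, inner_neg_left] at h1
  linarith

theorem hasFDerivAt_surrogate (α : EuclideanSpace ℝ (Fin m)) (x y : EuclideanSpace ℝ (Fin n)) :
    HasFDerivAt (surrogate F α x)
      (fderiv ℝ F x + (innerSL ℝ (y - x)).smulRight α) y := by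
  have h1 : HasFDerivAt (fun y => y - x) (ContinuousLinearMap.id ℝ _) y :=
    (hasFDerivAt_id y).sub_const x
  have h2 := (((fderiv ℝ F x).hasFDerivAt.comp y h1).const_add (F x)).add
    ((h1.norm_sq.mul_const (1 / 2)).smul_const α)
  refine (h2.congr_fderiv ?_).congr_of_eventuallyEq (.of_forall fun z => ?_)
  · ext v
    simp
  · simp [surrogate, div_eq_mul_inv]

/-- The surrogate is exactly quadratic in its last argument, and stationarity at `y` removes the
linear term after pairing with `ν`. -/
theorem inner_surrogate_sub_eq {α ν : EuclideanSpace ℝ (Fin m)} {x y : EuclideanSpace ℝ (Fin n)}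
    (hν : ν ∈ multipliers g F α x y) (z : EuclideanSpace ℝ (Fin n)) :
    inner ℝ (surrogate F α x z - surrogate F α x y) ν
      = inner ℝ α ν / 2 * ‖z - y‖ ^ 2 := by
  have h1 : inner ℝ (fderiv ℝ F x (z - y) + inner ℝ (y - x) (z - y) • α) ν = 0 := by
    have h2 := ContinuousLinearMap.adjoint_inner_right (fderiv ℝ (surrogate F α x) y) (z - y) ν
    rw [hν.2, inner_zero_right, (hasFDerivAt_surrogate α x y).fderiv] at h2
    simpa [inner_sub_left] using h2.symm
  have h2 : surrogate F α x z - surrogate F α x y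
      = (fderiv ℝ F x (z - y) + inner ℝ (y - x) (z - y) • α) + (‖z - y‖ ^ 2 / 2) • α := by
    have e1 : z - x = (y - x) + (z - y) := by module
    rw [surrogate, surrogate, e1, norm_add_sq_real, map_add]
    module
  rw [h2, inner_add_left, h1, inner_smul_left]
  simp
  ring

/-- The basic estimate for one step in terms of a multiplier. -/
theorem IsStep.toReal_sub_le_of_mem_multipliers {α ν : EuclideanSpace ℝ (Fin m)}
    {x y z : EuclideanSpace ℝ (Fin n)} (hs : IsStep g F L α x y) (h : IsModel g F L)
    (hz : F z ∈ dom g) (hν : ν ∈ multipliers g F α x y) :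
    (g (F y)).toReal - (g (F z)).toReal
      ≤ inner ℝ α ν / 2 * (‖x - z‖ ^ 2 - ‖y - z‖ ^ 2) := by
  have h1 := hν.1.2 (F z)
  rw [← coe_toReal_of_mem_dom h.ne_bot hν.1.1, ← coe_toReal_of_mem_dom h.ne_bot hz,
    ← EReal.coe_add, EReal.coe_le_coe_iff] at h1
  have h2 := toReal_le_of_le h.ne_bot (hs.le_surrogate h) hν.1.1
  have h3 := inner_nonneg_of_mem_subdifferential h hν.1 (h.coordLE_linearization x z).sub_nonneg
  have h4 : F z - surrogate F α x y = (F z - linearization F x z)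
      + (surrogate F α x z - surrogate F α x y) - (‖z - x‖ ^ 2 / 2) • α := by
    rw [surrogate_eq α x z]
    module
  rw [h4, inner_sub_left, inner_add_left, inner_surrogate_sub_eq hν, inner_smul_left,
    RCLike.conj_to_real] at h1
  rw [norm_sub_rev x z, norm_sub_rev y z]
  linarith

/-! ### Invariants of the generated sequences. -/

namespace IsGenerated

variable {η : ℝ} {x : ℕ → EuclideanSpace ℝ (Fin n)} {α : ℕ → EuclideanSpace ℝ (Fin m)}

theorem isStep_of_lineSearch (hg : IsGenerated g F L η x α) (h : IsModel g F L) {k : ℕ}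
    (hα : α k ∈ stepSet L) (hB : ∀ i, α k i ≤ stepBound L η (α 0) i) :
    (IsStep g F L (α (k + 1)) (x k) (x (k + 1)) ∧
      ∀ i, α (k + 1) i ≤ stepBound L η (α 0) i) ∧
    (x k ∈ argmin (g ∘ F) → x (k + 1) = x k) := by
  obtain ⟨y, hy, hstay, hmove⟩ := hg.step k
  obtain ⟨hs, hle⟩ := hy.isStep h hg.one_lt (fun i => le_max_left _ _) hα hB
  refine ⟨⟨?_, hle⟩, fun hk => hstay (hs.mem_prox_self_of_mem_argmin h hk)⟩
  by_cases hx : x k ∈ prox g F (α (k + 1)) (x k)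
  · rw [hstay hx]
    exact .refl_of_mem_prox hs.mem_stepSet hx
  · rw [hmove hx]
    exact hs

theorem step_mem_and_le (hg : IsGenerated g F L η x α) (h : IsModel g F L) (k : ℕ) :
    α k ∈ stepSet L ∧ ∀ i, α k i ≤ stepBound L η (α 0) i := by
  induction k with
  | zero => exact ⟨hg.init_step, fun i => le_max_right _ _⟩
  | succ k ih =>
    have hs := (hg.isStep_of_lineSearch h ih.1 ih.2).1
    exact ⟨hs.1.mem_stepSet, hs.2⟩

theorem isStep (hg : IsGenerated g F L η x α) (h : IsModel g F L) (k : ℕ) :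
    IsStep g F L (α (k + 1)) (x k) (x (k + 1)) :=
  (hg.isStep_of_lineSearch h (hg.step_mem_and_le h k).1 (hg.step_mem_and_le h k).2).1.1

theorem succ_eq_of_mem_argmin (hg : IsGenerated g F L η x α) (h : IsModel g F L) {k : ℕ}
    (hk : x k ∈ argmin (g ∘ F)) : x (k + 1) = x k :=
  (hg.isStep_of_lineSearch h (hg.step_mem_and_le h k).1 (hg.step_mem_and_le h k).2).2 hk

theorem eq_of_mem_argmin (hg : IsGenerated g F L η x α) (h : IsModel g F L) {k l : ℕ}
    (hkl : k ≤ l) (hk : x k ∈ argmin (g ∘ F)) : x l = x k := by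
  induction l, hkl using Nat.le_induction with
  | base => rfl
  | succ l _ ih => rw [hg.succ_eq_of_mem_argmin h (ih ▸ hk), ih]

theorem mem_dom (hg : IsGenerated g F L η x α) (h : IsModel g F L) (k : ℕ) :
    F (x k) ∈ dom g := by
  induction k with
  | zero => exact hg.init_x
  | succ k ih => exact mem_dom_of_le ((hg.isStep h k).le h) ih

theorem antitone_toReal (hg : IsGenerated g F L η x α) (h : IsModel g F L) :
    Antitone fun k => (g (F (x k))).toReal :=
  antitone_nat_of_succ_le fun k => toReal_le_of_le h.ne_bot ((hg.isStep h k).le h) (hg.mem_dom h k)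

theorem stepBound_mem (hg : IsGenerated g F L η x α) : stepBound L η (α 0) ∈ stepSet L :=
  stepBound_mem_stepSet η hg.init_step

/-! ### The rate in function values. -/

section Rate

variable {xs : EuclideanSpace ℝ (Fin n)} {ν : ℕ → EuclideanSpace ℝ (Fin m)}

theorem inner_le_inner_stepBound (hg : IsGenerated g F L η x α) (h : IsModel g F L)
    (hν : ∀ j, ν (j + 1) ∈ multipliers g F (α (j + 1)) (x j) (x (j + 1))) (j : ℕ) :
    0 ≤ inner ℝ (α (j + 1)) (ν (j + 1)) ∧
      inner ℝ (α (j + 1)) (ν (j + 1)) ≤ inner ℝ (stepBound L η (α 0)) (ν (j + 1)) := by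
  obtain ⟨hα, hle⟩ := hg.step_mem_and_le h (j + 1)
  refine ⟨inner_nonneg_of_mem_subdifferential h (hν j).1 (coordLE_zero_of_mem_stepSet hα), ?_⟩
  have h1 := inner_nonneg_of_mem_subdifferential h (hν j).1
    (coordLE_of_mem_stepSet hα hg.stepBound_mem hle).sub_nonneg
  rw [inner_sub_left] at h1
  linarith

theorem toReal_sub_le (hg : IsGenerated g F L η x α) (h : IsModel g F L)
    (hxs : xs ∈ argmin (g ∘ F))
    (hν : ∀ j, ν (j + 1) ∈ multipliers g F (α (j + 1)) (x j) (x (j + 1))) {k : ℕ} (hk : 1 ≤ k)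
    {C : ℝ} (hC : ∀ j < k, inner ℝ (stepBound L η (α 0)) (ν (j + 1)) ≤ C) :
    (g (F (x k))).toReal - (g (F xs)).toReal ≤ C / (2 * k) * ‖x 0 - xs‖ ^ 2 := by
  have hxsd : F xs ∈ dom g := lt_of_le_of_lt (hxs (x 0)) hg.init_x
  have hC0 : 0 ≤ C := by
    have h1 := hg.inner_le_inner_stepBound h hν 0
    exact (h1.1.trans h1.2).trans (hC 0 hk)
  by_cases hopt : x k ∈ argmin (g ∘ F)
  · have h1 : (g (F (x k))).toReal ≤ (g (F xs)).toReal :=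
      toReal_le_of_le h.ne_bot (hopt xs) hxsd
    have h2 : 0 ≤ C / (2 * k) * ‖x 0 - xs‖ ^ 2 := by positivity
    linarith
  have hgap : 0 < (g (F (x k))).toReal - (g (F xs)).toReal := by
    by_contra! hle
    exact hopt fun z =>
      (le_of_toReal_le h.ne_bot (hg.mem_dom h k) (by linarith : _ ≤ (g (F xs)).toReal)).trans
        (hxs z)
  have hstep : ∀ j < k, (g (F (x k))).toReal - (g (F xs)).toReal
      ≤ C / 2 * (‖x j - xs‖ ^ 2 - ‖x (j + 1) - xs‖ ^ 2) := fun j hj => by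
    have h1 := (hg.isStep h j).toReal_sub_le_of_mem_multipliers h hxsd (hν j)
    have h2 : (g (F (x k))).toReal ≤ (g (F (x (j + 1)))).toReal := hg.antitone_toReal h hj
    obtain ⟨h3, h4⟩ := hg.inner_le_inner_stepBound h hν j
    -- The gap is still positive at `k`, so the basic estimate itself forces this sign; only then
    -- may its coefficient be enlarged to `C / 2`.
    have h5 : 0 ≤ ‖x j - xs‖ ^ 2 - ‖x (j + 1) - xs‖ ^ 2 := by
      by_contra! hneg
      have := mul_nonpos_of_nonneg_of_nonpos (div_nonneg h3 zero_le_two) hneg.le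
      linarith
    have h6 := mul_le_mul_of_nonneg_right (h4.trans (hC j hj)) h5
    linarith
  have hsum := Finset.sum_le_sum fun j (hj : j ∈ Finset.range k) =>
    hstep j (Finset.mem_range.1 hj)
  rw [← Finset.mul_sum, Finset.sum_range_sub' (fun j => ‖x j - xs‖ ^ 2), Finset.sum_const,
    Finset.card_range, nsmul_eq_mul] at hsum
  have hk0 : (0 : ℝ) < k := by exact_mod_cast hk
  have h7 := mul_nonneg hC0 (sq_nonneg ‖x k - xs‖)
  rw [div_mul_eq_mul_div, le_div_iff₀ (by positivity)]
  nlinarith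

end Rate

/-! ### Convergence of values and iterates. -/

section Convergence

variable {xs : EuclideanSpace ℝ (Fin n)}

theorem antitone_norm_sub (hg : IsGenerated g F L η x α) (h : IsModel g F L)
    (hxs : xs ∈ argmin (g ∘ F)) (hne : ∀ k, x k ∉ argmin (g ∘ F)) :
    Antitone fun k => ‖xs - x k‖ :=
  antitone_nat_of_succ_le fun k => (hg.isStep h k).norm_sub_le h (hg.mem_dom h k) hxs (hne _)

theorem tendsto_toReal (hg : IsGenerated g F L η x α) (h : IsModel g F L)
    (hxs : xs ∈ argmin (g ∘ F)) (hne : ∀ k, x k ∉ argmin (g ∘ F))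
    {xb : EuclideanSpace ℝ (Fin n)} (hxb : F xb ∈ interior (dom g)) :
    Tendsto (fun k => (g (F (x k))).toReal) atTop (𝓝 (g (F xs)).toReal) := by
  have hxsd : F xs ∈ dom g := lt_of_le_of_lt (hxs (x 0)) hg.init_x
  have hlow : ∀ k, (g (F xs)).toReal ≤ (g (F (x k))).toReal := fun k =>
    toReal_le_of_le h.ne_bot (hxs (x k)) (hg.mem_dom h k)
  obtain ⟨a, ha⟩ : ∃ a, Tendsto (fun k => (g (F (x k))).toReal) atTop (𝓝 a) :=
    ⟨_, tendsto_atTop_ciInf (hg.antitone_toReal h) ⟨_, Set.forall_mem_range.2 hlow⟩⟩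
  suffices hle : a ≤ (g (F xs)).toReal by
    rwa [le_antisymm hle (ge_of_tendsto' ha hlow)] at ha
  obtain ⟨r, hrd, hr⟩ : ∃ r : ℝ, F xb + r • stepBound L η (α 0) ∈ dom g ∧ 0 < r := by
    have hc : Tendsto (fun r : ℝ => F xb + r • stepBound L η (α 0)) (𝓝[>] 0) (𝓝 (F xb)) := by
      have : Continuous fun r : ℝ => F xb + r • stepBound L η (α 0) := by fun_prop
      simpa using (this.tendsto 0).mono_left nhdsWithin_le_nhds
    exact ((hc.eventually (mem_interior_iff_mem_nhds.1 hxb)).and self_mem_nhdsWithin).exists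
  set M := (g (F xb + r • stepBound L η (α 0))).toReal
  have hmain : ∀ s : ℝ, 0 < s → s ≤ 1 → a ≤ (1 - s) * (g (F xs)).toReal + s * M := by
    intro s hs0 hs1
    set D := ‖xb - xs‖ + ‖xs - x 0‖
    have hD : ∀ k, ‖xs + s • (xb - xs) - x k‖ ≤ D := fun k => by
      have e : xs + s • (xb - xs) - x k = s • (xb - xs) + (xs - x k) := by module
      rw [e]
      refine (norm_add_le _ _).trans (add_le_add ?_ (hg.antitone_norm_sub h hxs hne k.zero_le))
      rw [norm_smul, Real.norm_of_nonneg hs0.le]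
      exact mul_le_of_le_one_left (norm_nonneg _) hs1
    -- Since `D` bounds the distances for all `k`, one `t` serves every iteration; the `+ 1` covers
    -- `D = 0`.
    obtain ⟨t, ht0, ht1, ht⟩ : ∃ t : ℝ, 0 < t ∧ t ≤ 1 ∧ t * D ^ 2 / 2 ≤ s * r := by
      refine ⟨min 1 (2 * (s * r) / (D ^ 2 + 1)), by positivity, min_le_left _ _, ?_⟩
      have h1 := min_le_right 1 (2 * (s * r) / (D ^ 2 + 1))
      rw [le_div_iff₀ (by positivity)] at h1
      have h2 : 0 < min 1 (2 * (s * r) / (D ^ 2 + 1)) := by positivity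
      linarith
    have hstep : ∀ k, (g (F (x (k + 1)))).toReal ≤ (1 - t) * (g (F (x k))).toReal
        + t * ((1 - s) * (g (F xs)).toReal + s * M) := fun k => by
      refine (hg.isStep h k).toReal_le_of_slater h (hg.mem_dom h k) hg.stepBound_mem
        (hg.step_mem_and_le h (k + 1)).2 hxsd hrd hs0.le hs1 ht0.le ht1 (le_trans ?_ ht)
      gcongr
      exact hD k
    -- In the limit both sides contain `a`, and `t > 0` cancels.
    have hlim := le_of_tendsto_of_tendsto' ((tendsto_add_atTop_iff_nat 1).2 ha)
      ((ha.const_mul (1 - t)).add_const _) hstep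
    nlinarith
  have hlim : Tendsto (fun s : ℝ => (1 - s) * (g (F xs)).toReal + s * M) (𝓝[>] 0)
      (𝓝 (g (F xs)).toReal) := by
    have : Continuous fun s : ℝ => (1 - s) * (g (F xs)).toReal + s * M := by fun_prop
    simpa using (this.tendsto 0).mono_left nhdsWithin_le_nhds
  refine ge_of_tendsto hlim ?_
  filter_upwards [Ioc_mem_nhdsGT (zero_lt_one (α := ℝ))] with s hs using hmain s hs.1 hs.2

theorem exists_tendsto (hg : IsGenerated g F L η x α) (h : IsModel g F L)
    (hlsc : LowerSemicontinuous g) (hmin : (argmin (g ∘ F)).Nonempty)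
    (hqual : ∃ xb, F xb ∈ interior (dom g)) :
    ∃ xinf ∈ argmin (g ∘ F), Tendsto x atTop (𝓝 xinf) := by
  by_cases hne : ∀ k, x k ∉ argmin (g ∘ F)
  swap
  · push Not at hne
    obtain ⟨k, hk⟩ := hne
    exact ⟨x k, hk, tendsto_const_nhds.congr' <| (eventually_ge_atTop k).mono fun l hl =>
      (hg.eq_of_mem_argmin h hl hk).symm⟩
  obtain ⟨xs, hxs⟩ := hmin
  obtain ⟨xb, hxb⟩ := hqual
  have hval := hg.tendsto_toReal h hxs hne hxb
  obtain ⟨xinf, -, φ, hφ, hsub⟩ := tendsto_subseq_of_bounded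
    (Metric.isBounded_closedBall (x := xs) (r := ‖xs - x 0‖)) (x := x) fun k => by
      rw [Metric.mem_closedBall, dist_comm, dist_eq_norm]
      exact hg.antitone_norm_sub h hxs hne k.zero_le
  have hxsd : F xs ∈ dom g := lt_of_le_of_lt (hxs (x 0)) hg.init_x
  have hinf : xinf ∈ argmin (g ∘ F) := by
    refine fun z => le_trans ?_ (hxs z)
    have hF : Tendsto (fun k => F (x (φ k))) atTop (𝓝 (F xinf)) :=
      (h.differentiable_map.continuous.tendsto xinf).comp hsub
    have hgv : Tendsto (fun k => g (F (x (φ k)))) atTop (𝓝 (g (F xs))) := by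
      have := (continuous_coe_real_ereal.tendsto _).comp (hval.comp hφ.tendsto_atTop)
      rw [coe_toReal_of_mem_dom h.ne_bot hxsd] at this
      exact this.congr fun k => coe_toReal_of_mem_dom h.ne_bot (hg.mem_dom h _)
    refine le_of_forall_lt fun c hc => ?_
    exact (lt_or_ge c _).elim id fun hle => by
      obtain ⟨d, hcd, hd⟩ := exists_between hc
      have h1 := ge_of_tendsto hgv ((hF.eventually (hlsc _ d hd)).mono fun _ => le_of_lt)
      exact hcd.trans_le h1
  refine ⟨xinf, hinf, ?_⟩
  rw [tendsto_iff_norm_sub_tendsto_zero] at hsub ⊢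
  -- The cluster point is itself a minimizer, so the distance to it is monotone and the subsequence
  -- decides the limit.
  have hanti : Antitone fun k => ‖x k - xinf‖ := by
    simpa only [norm_sub_rev] using hg.antitone_norm_sub h hinf hne
  exact (tendsto_iff_tendsto_subseq_of_antitone hanti hφ.tendsto_atTop).2 hsub

end Convergence

end IsGenerated

end Multiprox

theorem mainTheorem11 {n m : ℕ}
    (g : EuclideanSpace ℝ (Fin m) → EReal)
    (F : EuclideanSpace ℝ (Fin n) → EuclideanSpace ℝ (Fin m))
    (L : Fin m → ℝ≥0)
    -- the components of `F` are `C¹` and convex with `L i`-Lipschitz gradient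
    (hF_smooth : ∀ i, ContDiff ℝ 1 (fun x => F x i))
    (hF_convex : ∀ i, ConvexOn ℝ Set.univ (fun x => F x i))
    (hF_lip : ∀ i, LipschitzWith (L i) (gradient (fun x => F x i)))
    -- `g` is proper, convex, lower semicontinuous, and Lipschitz on its domain
    (hg_proper : Multiprox.IsProper g)
    (hg_convex : ConvexOn ℝ (Multiprox.dom g) (fun z => (g z).toReal))
    (hg_lsc : LowerSemicontinuous g)
    (hg_lip : ∃ Lg : ℝ≥0, LipschitzOnWith Lg (fun z => (g z).toReal) (Multiprox.dom g))
    (hg_mono : ∀ i, 0 < L i → Multiprox.MonotoneInCoord g i)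
    -- `g ∘ F` is proper and has a minimizer
    (h_proper : Multiprox.IsProper (g ∘ F))
    (h_min : (Multiprox.argmin (g ∘ F)).Nonempty)
    -- qualification
    (h_qual : ∃ xbar, F xbar ∈ interior (Multiprox.dom g))
    -- the subproblems have minimizers
    (h_sub : ∀ x, F x ∈ Multiprox.dom g → ∀ α ∈ Multiprox.stepSet L,
      (Multiprox.prox g F α x).Nonempty)
    (η : ℝ)
    (x : ℕ → EuclideanSpace ℝ (Fin n)) (α : ℕ → EuclideanSpace ℝ (Fin m))
    (h_gen : Multiprox.IsGenerated g F L η x α) :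
    Multiprox.stepBound L η (α 0) ∈ Multiprox.stepSet L ∧
    (∀ xs ∈ Multiprox.argmin (g ∘ F), ∀ ν : ℕ → EuclideanSpace ℝ (Fin m),
      (∀ j, ν (j + 1) ∈ Multiprox.multipliers g F (α (j + 1)) (x j) (x (j + 1))) →
      ∀ (k : ℕ) (hk : 1 ≤ k),
        g (F (x k)) - g (F xs) ≤
          ((((Finset.Icc 1 k).sup' (Finset.nonempty_Icc.mpr hk)
              (fun j => inner ℝ (Multiprox.stepBound L η (α 0)) (ν j))) / (2 * (k : ℝ))
            * ‖x 0 - xs‖ ^ 2 : ℝ) : EReal)) ∧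
    ∃ xinf ∈ Multiprox.argmin (g ∘ F), Tendsto x atTop (𝓝 xinf) := by
  have h : Multiprox.IsModel g F L :=
    ⟨fun i => (hF_smooth i).differentiable one_ne_zero, hF_convex, hF_lip, hg_proper.1, hg_convex,
      hg_mono⟩
  refine ⟨h_gen.stepBound_mem, fun xs hxs ν hν k hk => ?_,
    h_gen.exists_tendsto h hg_lsc h_min h_qual⟩
  have hxsd : F xs ∈ Multiprox.dom g := Multiprox.mem_dom_of_mem_argmin h_proper hxs
  rw [← Multiprox.coe_toReal_of_mem_dom h.ne_bot (h_gen.mem_dom h k),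
    ← Multiprox.coe_toReal_of_mem_dom h.ne_bot hxsd, ← EReal.coe_sub, EReal.coe_le_coe_iff]
  exact h_gen.toReal_sub_le h hxs hν hk fun j hj =>
    Finset.le_sup' (fun j => inner ℝ (Multiprox.stepBound L η (α 0)) (ν j))
      (Finset.mem_Icc.2 ⟨Nat.succ_pos j, hj⟩)
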